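/- \textbf{Definitions.} A \emph{hyper arc diagram} is a permutation $\alpha\in\mathbb S_m$ ($m\ge 0$) of the points $1<2<\dots<m$ of an oriented line (the \emph{legs}); its \emph{hyper arcs} are the cycles of $\alpha$, fixed points included. The concatenation $\alpha_1\#\alpha_2\in\mathbb S_{m+n}$ of $\alpha_1\in\mathbb S_m$ and $\alpha_2\in\mathbb S_n$ acts as $\alpha_1$ on the first $m$ points and as $\alpha_2$ on the last $n$ points. An \emph{extended permutation graph} is a graph with linearly ordered vertices, all of valency $2$ (loops and multiple edges allowed), in which one of the two half-edges at each vertex is marked as head and the other one as tail. An edge may consist of a head and a tail, of two heads, or of two tails. A permutation $\alpha$ is regarded as the graph whose edges join the tail at $v$ to the head at $\alpha(v)$. The universal $\mathfrak{so}$-weight system is the function $w=w_{\mathfrak{so}}$ on permutations of any number of elements, with values in $\mathbb C[N,C_2,C_4,C_6,\dots]$, defined by the following axioms. \begin{enumerate} \item $w(\alpha_1\#\alpha_2)=w(\alpha_1)\,w(\alpha_2)$. \item If $\alpha'$ is obtained from $\alpha$ by inverting one cycle of length $\ell\ge 1$, then $w(\alpha')=(-1)^{\ell}w(\alpha)$.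 \item For each even $m\ge 2$, $w$ takes the value $C_m$ on the standard cycle $1\mapsto 2\mapsto\dots\mapsto m\mapsto 1$. \item Extend $w$ to extended permutation graphs by requiring that exchanging the head and the tail at a vertex multiplies the value by $-1$; by axiom 2 this is consistent. Then for each $\alpha\in\mathbb S_m$ and each $1\le k<m$, $$w(\alpha)=w(\alpha')+w(\beta_1)-w(\beta_2)+w(\gamma_1)-w(\gamma_2).$$ Here $\alpha'$ is obtained from $\alpha$ by exchanging the vertices $k$ and $k+1$. Each of $\beta_1,\beta_2,\gamma_1,\gamma_2$ is obtained from the graph of $\alpha$ by removing one half-edge at $k$ and one half-edge at $k+1$, joining the two edges to which they belong into one edge, and replacing $k,k+1$ by a single vertex that carries the two remaining half-edges. If $h_v,t_v$ denote the head and the tail at $v$, then: \begin{itemize} \item for $\beta_1$, $t_k$ and $h_{k+1}$ are joined, and the new vertex has head $h_k$ and tail $t_{k+1}$; \item for $\beta_2$, $h_k$ and $t_{k+1}$ are joined, and the new vertex has head $h_{k+1}$ and tail $t_k$; \item for $\gamma_1$, $h_k$ and $h_{k+1}$ are joined, and the new vertex has head $t_{k+1}$ and tail $t_k$; \item for $\gamma_2$,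 $t_k$ and $t_{k+1}$ are joined, and the new vertex has head $h_k$ and tail $h_{k+1}$. \end{itemize} If the two joined half-edges form one edge, a loop without vertices splits off; it is removed and contributes the factor $N$. \end{enumerate} \textbf{Theorem.} The universal $\mathfrak{so}$-weight system $w_{\mathfrak{so}}$ satisfies the generalized Vassiliev relations. That is, consider a hyper arc diagram with one leg chosen as the free leg, let $v_1$ be the hyper arc containing it, and keep the order of all other legs and the cyclic structure of all hyper arcs. For a leg $j$ other than the free leg, let $\alpha_j^-$ and $\alpha_j^+$ be the diagrams in which the free leg is placed immediately before and immediately after $j$, respectively. Then \begin{itemize} \item (one-hyper-arc relation) $\displaystyle\sum_{j}\bigl(w_{\mathfrak{so}}(\alpha_j^-)-w_{\mathfrak{so}}(\alpha_j^+)\bigr)=0$, where $j$ runs over all legs of $v_1$ other than the free leg; \item (two-hyper-arc relation) $\displaystyle\sum_{j\in v_2}\bigl(w_{\mathfrak{so}}(\alpha_j^-)-w_{\mathfrak{so}}(\alpha_j^+)\bigr)=0$ for every hyper arc $v_2\ne v_1$, where $j$ runs over all legs of $v_2$. \end{itemize} -/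

import Mathlib

open Equiv

/-- Generators of the target ring: `N`, and `C r` standing for the generator `C_{2r}`, `r ≥ 1`. -/
inductive SOGen : Type
  | N : SOGen
  | C (r : ℕ+) : SOGen

/-- The polynomial ring `ℂ[N, C₂, C₄, C₆, …]`. -/
abbrev SORing : Type := MvPolynomial SOGen ℂ

/-- A function on permutations of any number of elements `0, 1, …, m - 1`
(equivalently, on hyper arc diagrams). -/
abbrev PermFunction : Type := (m : ℕ) → Perm (Fin m) → SORing

/-- The concatenation `α # β`: `α` acts on the first `m` points, `β` on the last `n` points. -/
def permConcat {m n : ℕ} (α : Perm (Fin m)) (β : Perm (Fin n)) : Perm (Fin (m + n)) :=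
  finSumFinEquiv.permCongr (Perm.sumCongr α β)

/-- The permutation obtained from `α` by inverting the cycle (possibly a fixed point)
that contains `v`. -/
noncomputable def reverseCycle {m : ℕ} (α : Perm (Fin m)) (v : Fin m) : Perm (Fin m) :=
  open Classical in α * ((α.cycleOf v) ^ 2)⁻¹

theorem reverseCycle_apply {m : ℕ} (α : Perm (Fin m)) (v x : Fin m) [Decidable (α.SameCycle v x)] :
    reverseCycle α v x = if α.SameCycle v x then α⁻¹ x else α x := by
  classical
  have key : ∀ y, ((α.cycleOf v)⁻¹) y = if α.SameCycle v y then α⁻¹ y else y := by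
    intro y
    rw [Perm.cycleOf_inv, Perm.cycleOf_apply]
    simp only [Perm.sameCycle_inv]
  have h2 : reverseCycle α v x = α ((α.cycleOf v)⁻¹ ((α.cycleOf v)⁻¹ x)) := by
    unfold reverseCycle
    rw [← inv_pow, pow_two, Perm.mul_apply, Perm.mul_apply]
  rw [h2, key x]
  split_ifs with h
  · rw [key, if_pos (by simpa using h)]
    simp
  · rw [key, if_neg h]

/-- The length of the cycle of `α` that contains `v` (it is `1` if `v` is a fixed point). -/
noncomputable def cycleLength {m : ℕ} (α : Perm (Fin m)) (v : Fin m) : ℕ :=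
  {u | α.SameCycle v u}.ncard

/-- Half-edges at `m` linearly ordered vertices of valency two:
`(v, true)` is the head at `v`, `(v, false)` is the tail at `v`. -/
abbrev HalfEdge (m : ℕ) : Type := Fin m × Bool

/-- An extended permutation graph on the vertices `0 < 1 < … < m - 1`: every vertex carries one head
and one tail, and the half-edges are joined in pairs to form the edges, where an edge may have
a head and a tail, two heads, or two tails. -/
@[ext]
structure ExtGraph (m : ℕ) where
  /-- The other half of the edge containing a given half-edge. -/
  mate : HalfEdge m → HalfEdge m
  mate_mate : ∀ h, mate (mate h) = h
  mate_ne : ∀ h, mate h ≠ h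

namespace ExtGraph

/-- The graph of a permutation: one edge from the tail at `v` to the head at `α v`, for each `v`. -/
def ofPerm {m : ℕ} (α : Perm (Fin m)) : ExtGraph m where
  mate h := if h.2 then (α⁻¹ h.1, false) else (α h.1, true)
  mate_mate := by
    rintro ⟨v, b⟩
    cases b <;> simp
  mate_ne := by
    rintro ⟨v, b⟩
    cases b <;> simp

/-- Exchange the head and the tail at the vertex `v`. -/
def flip {m : ℕ} (G : ExtGraph m) (v : Fin m) : ExtGraph m where
  mate h := swap (v, true) (v, false) (G.mate (swap (v, true) (v, false) h))
  mate_mate h := by simp [G.mate_mate]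
  mate_ne h e := by
    apply G.mate_ne (swap (v, true) (v, false) h)
    have := congrArg (swap (v, true) (v, false)) e
    simpa using this

/-- The half-edges that remain when the half-edge of kind `a` at the vertex `k` and the half-edge of
kind `b` at the vertex `k + 1` are removed and these two vertices are replaced by a single vertex `k`.
The new vertex inherits one half-edge from `k`, of the kind `!a` it had, and one half-edge
from `k + 1`, which receives the kind `a`. -/
def mergeIncl {m : ℕ} (k : Fin m) (a b : Bool) (h : HalfEdge m) : HalfEdge (m + 1) :=
  if h = (k, a) then (k.succ, !b) else (k.succ.succAbove h.1, h.2)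

/-- The inverse of `mergeIncl` on the half-edges that remain. -/
def mergeProj {m : ℕ} (k : Fin m) (a : Bool) (h : HalfEdge (m + 1)) : HalfEdge m :=
  (k.predAbove h.1, if h.1 = k.succ then a else h.2)

/-- The pairing obtained from that of `G` by removing the half-edges `p` and `q` and joining the
half-edges that were paired with them. -/
def joinMate {m : ℕ} (G : ExtGraph m) (p q h : HalfEdge m) : HalfEdge m :=
  if G.mate h = p then G.mate q else if G.mate h = q then G.mate p else G.mate h

theorem mergeProj_incl {m : ℕ} (k : Fin m) (a b : Bool) (h : HalfEdge m) :
    mergeProj k a (mergeIncl k a b h) = h := by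
  obtain ⟨v, c⟩ := h
  unfold mergeIncl mergeProj
  split_ifs with h1 h2 h2
  · simp_all
  · simp at h2
  · exact absurd h2 (Fin.succAbove_ne _ _)
  · simp only [Prod.mk.injEq, and_true]
    rcases lt_or_ge k v with h | h
    · rw [Fin.succAbove_of_le_castSucc _ _ (Fin.succ_le_castSucc_iff.2 h),
        Fin.predAbove_succ_of_le _ _ h.le]
    · rw [Fin.succAbove_of_castSucc_lt _ _ (Fin.castSucc_lt_succ_iff.2 h),
        Fin.predAbove_castSucc_of_le _ _ h]

theorem mergeIncl_proj {m : ℕ} (k : Fin m) (a b : Bool) (h : HalfEdge (m + 1))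
    (hp : h ≠ (k.castSucc, a)) (hq : h ≠ (k.succ, b)) :
    mergeIncl k a b (mergeProj k a h) = h := by
  obtain ⟨v, c⟩ := h
  unfold mergeIncl mergeProj
  by_cases hv : v = k.succ
  · subst hv
    simp only [ne_eq, Prod.mk.injEq, true_and] at hq
    cases b <;> cases c <;> simp_all
  · simp only [hv, if_false]
    rw [Fin.succ_succAbove_predAbove hv, if_neg]
    intro e
    simp only [Prod.mk.injEq] at e
    apply hp
    have := Fin.succ_succAbove_predAbove hv
    rw [e.1, Fin.succAbove_succ_self] at this
    simp [← this, e.2]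

theorem mergeIncl_ne_left {m : ℕ} (k : Fin m) (a b : Bool) (h : HalfEdge m) :
    mergeIncl k a b h ≠ (k.castSucc, a) := by
  obtain ⟨v, c⟩ := h
  unfold mergeIncl
  split_ifs with h1
  · simp only [ne_eq, Prod.mk.injEq, not_and]
    intro e
    simp [Fin.ext_iff] at e
  · simp only [ne_eq, Prod.mk.injEq, not_and]
    intro e hc
    rw [← Fin.succAbove_succ_self k, Fin.succAbove_right_inj] at e
    exact h1 (by rw [e, hc])

theorem mergeIncl_ne_right {m : ℕ} (k : Fin m) (a b : Bool) (h : HalfEdge m) :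
    mergeIncl k a b h ≠ (k.succ, b) := by
  unfold mergeIncl
  split_ifs with h1
  · simp
  · simp only [ne_eq, Prod.mk.injEq, not_and]
    intro e
    exact absurd e (Fin.succAbove_ne _ _)

theorem joinMate_spec {m : ℕ} (G : ExtGraph m) {p q h : HalfEdge m} (hpq : p ≠ q)
    (hp : h ≠ p) (hq : h ≠ q) :
    joinMate G p q h ≠ p ∧ joinMate G p q h ≠ q ∧ joinMate G p q h ≠ h ∧
      joinMate G p q (joinMate G p q h) = h := by
  have mm := G.mate_mate
  have mn := G.mate_ne
  unfold joinMate
  grind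

/-- Replace the vertices `k` and `k + 1` by a single vertex `k`: the half-edge of kind `a` at `k` and
the half-edge of kind `b` at `k + 1` are removed and the edges they belong to are joined into one edge,
while the two other half-edges at `k` and `k + 1` become the half-edges at the new vertex, of kinds
`!a` and `a` respectively. All other vertices and half-edges stay as they are.
If the two removed half-edges form one edge of `G`, a loop without vertices splits off
and is dropped here; see `mergeLoops`. -/
def merge {m : ℕ} (G : ExtGraph (m + 1)) (k : Fin m) (a b : Bool) : ExtGraph m where
  mate h := mergeProj k a (joinMate G (k.castSucc, a) (k.succ, b) (mergeIncl k a b h))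
  mate_mate h := by
    have s := joinMate_spec G (by simp [Fin.ext_iff]) (mergeIncl_ne_left k a b h) (mergeIncl_ne_right k a b h)
    rw [mergeIncl_proj k a b _ s.1 s.2.1, s.2.2.2, mergeProj_incl]
  mate_ne h e := by
    have s := joinMate_spec G (by simp [Fin.ext_iff]) (mergeIncl_ne_left k a b h) (mergeIncl_ne_right k a b h)
    have := congrArg (mergeIncl k a b) e
    rw [mergeIncl_proj k a b _ s.1 s.2.1] at this
    exact s.2.2.1 this

/-- The number (`0` or `1`) of loops without vertices that split off in `merge`. -/
def mergeLoops {m : ℕ} (G : ExtGraph (m + 1)) (k : Fin m) (a b : Bool) : ℕ :=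
  if G.mate (k.castSucc, a) = (k.succ, b) then 1 else 0

end ExtGraph

/-- `W` extends `w` from permutation graphs to extended permutation graphs, in such a way that
exchanging the head and the tail at a vertex changes the sign. -/
structure IsSOExtension (w : PermFunction) (W : (m : ℕ) → ExtGraph m → SORing) : Prop where
  ofPerm : ∀ (m : ℕ) (α : Perm (Fin m)), W m (ExtGraph.ofPerm α) = w m α
  flip : ∀ (m : ℕ) (G : ExtGraph m) (v : Fin m), W m (G.flip v) = -W m G

/-- The value of `W` on the graph `G.merge k a b`, where a loop without vertices that
splits off contributes the factor `N`. -/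
noncomputable def mergeValue (W : (m : ℕ) → ExtGraph m → SORing) {m : ℕ} (G : ExtGraph (m + 1))
    (k : Fin m) (a b : Bool) : SORing :=
  MvPolynomial.X SOGen.N ^ G.mergeLoops k a b * W m (G.merge k a b)

/-- The defining axioms of the universal `𝔰𝔬`-weight system. In the recurrence rule the first term on
the right is the value on `α` with the vertices `k`, `k + 1` exchanged. In the four remaining terms,
for a vertex `v` with head `h_v` and tail `t_v`, the joined half-edges are respectively
`t_k` and `h_{k+1}`; `h_k` and `t_{k+1}`; `h_k` and `h_{k+1}`; `t_k` and `t_{k+1}`. -/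
structure IsUniversalSOWeightSystem (w : PermFunction) : Prop where
  concat : ∀ (m n : ℕ) (α : Perm (Fin m)) (β : Perm (Fin n)),
    w (m + n) (permConcat α β) = w m α * w n β
  reverse : ∀ (m : ℕ) (α : Perm (Fin m)) (v : Fin m),
    w m (reverseCycle α v) = (-1) ^ cycleLength α v * w m α
  cycle : ∀ r : ℕ+, w (2 * r) (finRotate (2 * r)) = MvPolynomial.X (SOGen.C r)
  recurrence : ∃ W : (m : ℕ) → ExtGraph m → SORing, IsSOExtension w W ∧
    ∀ (m : ℕ) (α : Perm (Fin (m + 1))) (k : Fin m),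
      w (m + 1) α =
        w (m + 1) (swap k.castSucc k.succ * α * swap k.castSucc k.succ)
        + mergeValue W (ExtGraph.ofPerm α) k false true
        - mergeValue W (ExtGraph.ofPerm α) k true false
        + mergeValue W (ExtGraph.ofPerm α) k true true
        - mergeValue W (ExtGraph.ofPerm α) k false false

/-- Given a permutation `α` of a free leg `none` and of `n` fixed legs `some 0, …, some (n - 1)`
placed along a line in this order, the hyper arc diagram obtained by placing the free leg
at the position `p` (that is, so that exactly `p` fixed legs precede it). -/
def insertFreeLeg {n : ℕ} (α : Perm (Option (Fin n))) (p : Fin (n + 1)) : Perm (Fin (n + 1)) :=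
  (finSuccEquiv' p).symm.permCongr α

open Classical in
/-- The alternating sum of the values of `w` in which the free leg takes all the positions next to
the fixed legs that belong to the cycle of `x`, with the sign `+` if it is immediately before the
fixed leg and `-` if it is immediately after it. -/
noncomputable def vassilievSum (w : PermFunction) {n : ℕ} (α : Perm (Option (Fin n)))
    (x : Option (Fin n)) : SORing :=
  ∑ j : Fin n with α.SameCycle x (some j),
    (w (n + 1) (insertFreeLeg α j.castSucc) - w (n + 1) (insertFreeLeg α j.succ))

/-- The generalized Vassiliev relations. One-hyper-arc: the fixed legs in question are the other legs
of the hyper arc of the free leg. Two-hyper-arc: they are all the legs of another hyper arc. -/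
structure SatisfiesGeneralizedVassilievRelations (w : PermFunction) : Prop where
  one_hyper_arc : ∀ (n : ℕ) (α : Perm (Option (Fin n))), vassilievSum w α none = 0
  two_hyper_arc : ∀ (n : ℕ) (α : Perm (Option (Fin n))) (i : Fin n),
    ¬ α.SameCycle none (some i) → vassilievSum w α (some i) = 0

/-! ### Surgery on fixed-point-free involutions -/

section Involution

variable {T : Type*} [DecidableEq T]

/-! Apply the recurrence to the free leg and the fixed leg `j` just after it. Its four extra terms
are indexed by a half-edge `x` at `j` and a half-edge `p` at the free leg: the edge of `x` is cut,
`x` is joined to the partner of `p`, and the other loose end to the partner of the second free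
half-edge `q`. After the sign rule for flips absorbs the relabelling in the head-head and tail-tail
terms, the sign depends only on whether `p` is head or tail (`mergeValue_insertFreeLeg`).

Now forget the free leg and sum over the edges of the remaining graph. For an edge `{x, y}`,
splicing at `x` with `p` and at `y` with `q` gives the same graph with opposite signs, so each edge
contributes zero (`cutValue_add_cutValue`). If the edge came from the free leg itself, all four
graphs agree and the loop factors `1` and `N` balance. The half-edges on one cycle are a union of
such edges, whether or not the cycle contains the free leg; hence both relations follow at once. -/

theorem swap_apply_swap_apply (x y z : T) : swap x y (swap x y z) = z := by simp

/-- The involution `M` with `p` and `q` removed and their partners matched to each other. -/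
def joinInvolution (M : T → T) (p q z : T) : T :=
  if M z = p then M q else if M z = q then M p else M z

/-- Exchange the roles of `x` and `p` in `M`, then remove `p` and `q`, matching their partners. -/
def cutJoin (M : T → T) (p q x z : T) : T :=
  swap x p (joinInvolution M x q (swap x p z))

theorem joinInvolution_spec {M : T → T} (mm : ∀ z, M (M z) = z) (mn : ∀ z, M z ≠ z)
    {p q z : T} (hpq : p ≠ q) (hp : z ≠ p) (hq : z ≠ q) :
    joinInvolution M p q z ≠ p ∧ joinInvolution M p q z ≠ q ∧ joinInvolution M p q z ≠ z ∧
      joinInvolution M p q (joinInvolution M p q z) = z := by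
  unfold joinInvolution
  grind

theorem cutJoin_spec {M : T → T} (mm : ∀ z, M (M z) = z) (mn : ∀ z, M z ≠ z)
    {p q x z : T} (hpq : p ≠ q) (hxq : x ≠ q) (hp : z ≠ p) (hq : z ≠ q) :
    cutJoin M p q x z ≠ p ∧ cutJoin M p q x z ≠ q ∧ cutJoin M p q x z ≠ z ∧
      cutJoin M p q x (cutJoin M p q x z) = z := by
  have hx : swap x p z ≠ x := fun e => hp (by simpa using congrArg (swap x p) e)
  have hq' : swap x p z ≠ q := fun e => hq (by
    simpa [swap_apply_of_ne_of_ne hxq.symm hpq.symm] using congrArg (swap x p) e)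
  obtain ⟨h1, h2, h3, h4⟩ := joinInvolution_spec mm mn hxq hx hq'
  unfold cutJoin
  refine ⟨fun e => h1 ?_, fun e => h2 ?_, fun e => h3 ?_, ?_⟩
  · simpa using congrArg (swap x p) e
  · simpa [swap_apply_of_ne_of_ne hxq.symm hpq.symm] using congrArg (swap x p) e
  · simpa using congrArg (swap x p) e
  · simp [h4]

/-- Cutting the edge between `x` and `M x` is symmetric in its ends: on both sides `x` takes the
place of `p` and `M x` that of `q`. -/
theorem cutJoin_mate {M : T → T} (mm : ∀ z, M (M z) = z) (mn : ∀ z, M z ≠ z)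
    {p q x z : T} (hpq : p ≠ q) (hxp : x ≠ p) (hxq : x ≠ q) (hyp : M x ≠ p) (hyq : M x ≠ q)
    (hp : z ≠ p) (hq : z ≠ q) :
    cutJoin M p q x z = cutJoin M q p (M x) z := by
  unfold cutJoin joinInvolution
  simp only [swap_apply_def]
  grind

/-- When `x` is adjacent to `p`, both choices only delete `p` and `q` and leave `x` matched to `M
q`. They differ by a loop without vertices, which a matching does not record. -/
theorem cutJoin_comm_of_mate {M : T → T} (mm : ∀ z, M (M z) = z) (mn : ∀ z, M z ≠ z)
    {p q x z : T} (hpq : p ≠ q) (hx : M x = p) (hp : z ≠ p) (hq : z ≠ q) :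
    cutJoin M p q x z = cutJoin M q p x z := by
  unfold cutJoin joinInvolution
  simp only [swap_apply_def]
  grind

/-- Both sides delete `p` and `q` and match `x` with `y`. -/
theorem cutJoin_of_mate_of_mate {M : T → T} (mm : ∀ z, M (M z) = z) (mn : ∀ z, M z ≠ z)
    {p q x y z : T} (hpq : p ≠ q) (hxq : x ≠ q) (hyp : y ≠ p) (hx : M x = p) (hy : M y = q)
    (hp : z ≠ p) (hq : z ≠ q) :
    cutJoin M p q x z = cutJoin M q p y z := by
  unfold cutJoin joinInvolution
  simp only [swap_apply_def]
  grind

end Involution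

/-! ### Half-edges of a diagram with a free leg -/

/-- The half-edges at the free leg `none` and at the fixed legs. -/
abbrev FreeHalfEdge (n : ℕ) : Type := Option (Fin n) × Bool

/-- A half-edge at a fixed leg. -/
def HalfEdge.toFree {n : ℕ} (h : HalfEdge n) : FreeHalfEdge n := (some h.1, h.2)

theorem HalfEdge.toFree_injective {n : ℕ} : Function.Injective (HalfEdge.toFree (n := n)) := by
  rintro ⟨u, b⟩ ⟨v, c⟩ h
  simpa [HalfEdge.toFree] using h

theorem HalfEdge.toFree_ne {n : ℕ} (h : HalfEdge n) (c : Bool) :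
    h.toFree ≠ ((none, c) : FreeHalfEdge n) := by
  simp [HalfEdge.toFree]

/-- The pairing of half-edges defined by a permutation of the free leg and the fixed legs. -/
def freeMate {n : ℕ} (α : Perm (Option (Fin n))) (h : FreeHalfEdge n) : FreeHalfEdge n :=
  if h.2 then (α⁻¹ h.1, false) else (α h.1, true)

theorem freeMate_freeMate {n : ℕ} (α : Perm (Option (Fin n))) (h : FreeHalfEdge n) :
    freeMate α (freeMate α h) = h := by
  obtain ⟨v, b⟩ := h
  cases b <;> simp [freeMate]

theorem freeMate_ne {n : ℕ} (α : Perm (Option (Fin n))) (h : FreeHalfEdge n) :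
    freeMate α h ≠ h := by
  obtain ⟨v, b⟩ := h
  cases b <;> simp [freeMate]

/-- Edges never leave a cycle; this keeps the final pairing of half-edges inside the index set of
the sum. -/
theorem sameCycle_freeMate {n : ℕ} (α : Perm (Option (Fin n))) (v : Option (Fin n))
    (h : FreeHalfEdge n) : α.SameCycle v (freeMate α h).1 ↔ α.SameCycle v h.1 := by
  obtain ⟨u, b⟩ := h
  cases b
  · exact Perm.sameCycle_apply_right
  · exact Perm.sameCycle_inv.symm.trans (Perm.sameCycle_apply_right.trans Perm.sameCycle_inv)

/-- The graph on the fixed legs whose pairing is the given involution, which is assumed to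
preserve the set of half-edges at the fixed legs. -/
def restrictFree {n : ℕ} (M : FreeHalfEdge n → FreeHalfEdge n)
    (hM : ∀ h : HalfEdge n, M h.toFree ≠ (none, true) ∧ M h.toFree ≠ (none, false) ∧
      M h.toFree ≠ h.toFree ∧ M (M h.toFree) = h.toFree) : ExtGraph n :=
  -- The default value of `getD` is never reached, since `M` sends no fixed half-edge to the free
  -- leg.
  have key : ∀ h : HalfEdge n,
      HalfEdge.toFree (((M h.toFree).1.getD h.1, (M h.toFree).2) : HalfEdge n) = M h.toFree := by
    intro h
    obtain ⟨h1, h2, -, -⟩ := hM h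
    generalize M h.toFree = z at h1 h2
    obtain ⟨_ | v, _ | _⟩ := z <;> simp_all [HalfEdge.toFree]
  { mate := fun h => ((M h.toFree).1.getD h.1, (M h.toFree).2)
    mate_mate := fun h => HalfEdge.toFree_injective (by rw [key, key, (hM h).2.2.2])
    mate_ne := fun h e => (hM h).2.2.1 (by rw [← key, e]) }

theorem toFree_restrictFree_mate {n : ℕ} (M : FreeHalfEdge n → FreeHalfEdge n) (hM)
    (h : HalfEdge n) : ((restrictFree M hM).mate h).toFree = M h.toFree := by
  obtain ⟨h1, h2, -, -⟩ := hM h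
  change HalfEdge.toFree (((M h.toFree).1.getD h.1, (M h.toFree).2) : HalfEdge n) = M h.toFree
  generalize M h.toFree = z at h1 h2
  obtain ⟨_ | v, _ | _⟩ := z <;> simp_all [HalfEdge.toFree]

/-- The graph on the fixed legs obtained by forgetting the free leg. -/
def forgetFree {n : ℕ} (α : Perm (Option (Fin n))) : ExtGraph n :=
  restrictFree (joinInvolution (freeMate α) (none, true) (none, false)) fun h =>
    joinInvolution_spec (freeMate_freeMate α) (freeMate_ne α) (by simp) (h.toFree_ne _)
      (h.toFree_ne _)

/-- The graph on the fixed legs in which the half-edge `x` is paired with the partner of the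
half-edge of kind `c` at the free leg, and the old partner of `x` with the partner of the
other half-edge at the free leg. -/
def cutGraph {n : ℕ} (α : Perm (Option (Fin n))) (x : HalfEdge n) (c : Bool) : ExtGraph n :=
  restrictFree (cutJoin (freeMate α) (none, c) (none, !c) x.toFree) fun h => by
    obtain ⟨h1, h2, h3⟩ := cutJoin_spec (freeMate_freeMate α) (freeMate_ne α)
      (p := (none, c)) (q := (none, !c)) (by simp) (x.toFree_ne _) (h.toFree_ne c) (h.toFree_ne (!c))
    cases c
    · exact ⟨h2, h1, h3⟩
    · exact ⟨h1, h2, h3⟩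

/-- The value of `W` on `cutGraph α x c`, with a factor `N` for a loop without vertices. -/
noncomputable def cutValue (W : (m : ℕ) → ExtGraph m → SORing) {n : ℕ}
    (α : Perm (Option (Fin n))) (x : HalfEdge n) (c : Bool) : SORing :=
  MvPolynomial.X SOGen.N ^ (if freeMate α x.toFree = (none, !c) then 1 else 0) *
    W n (cutGraph α x c)

theorem cutGraph_eq {n : ℕ} {α : Perm (Option (Fin n))} {x y : HalfEdge n} {c d : Bool}
    (h : ∀ z : HalfEdge n, cutJoin (freeMate α) (none, c) (none, !c) x.toFree z.toFree =
      cutJoin (freeMate α) (none, d) (none, !d) y.toFree z.toFree) :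
    cutGraph α x c = cutGraph α y d := by
  ext1
  funext z
  apply HalfEdge.toFree_injective
  unfold cutGraph
  rw [toFree_restrictFree_mate, toFree_restrictFree_mate, h]

/-! ### Cancellation along one edge -/

theorem cutValue_add_cutValue {W : (m : ℕ) → ExtGraph m → SORing} {n : ℕ}
    (α : Perm (Option (Fin n))) (x : HalfEdge n) (c : Bool) :
    cutValue W α x c + cutValue W α ((forgetFree α).mate x) c =
      cutValue W α x (!c) + cutValue W α ((forgetFree α).mate x) (!c) := by
  have mm := freeMate_freeMate α
  have mn := freeMate_ne α
  have hy : ((forgetFree α).mate x).toFree =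
      joinInvolution (freeMate α) (none, true) (none, false) x.toFree :=
    toFree_restrictFree_mate _ _ _
  generalize (forgetFree α).mate x = y at hy
  by_cases hf : ∃ d, freeMate α x.toFree = (none, d)
  -- The edge `{x, y}` passes through the free leg, so the four graphs coincide and only powers of
  -- `N` remain to be compared.
  · obtain ⟨d, hd⟩ := hf
    have hy' : freeMate α y.toFree = (none, !d) := by
      rw [hy, joinInvolution, hd]
      cases d <;> simp [mm]
    have e1 : cutGraph α x d = cutGraph α x (!d) := cutGraph_eq fun z => by
      have := cutJoin_comm_of_mate mm mn (p := (none, d)) (q := (none, !d)) (by simp)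
        hd (z.toFree_ne _) (z.toFree_ne _)
      simpa using this
    have e2 : cutGraph α y (!d) = cutGraph α y d := cutGraph_eq fun z => by
      have := cutJoin_comm_of_mate mm mn (p := (none, !d)) (q := (none, d)) (by simp)
        hy' (z.toFree_ne _) (z.toFree_ne _)
      simpa using this
    have e3 : cutGraph α x d = cutGraph α y (!d) := cutGraph_eq fun z => by
      have := cutJoin_of_mate_of_mate mm mn (p := (none, d)) (q := (none, !d)) (by simp)
        (x.toFree_ne _) (y.toFree_ne _) hd hy' (z.toFree_ne _) (z.toFree_ne _)
      simpa using this
    have key : cutValue W α x d + cutValue W α y d =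
        cutValue W α x (!d) + cutValue W α y (!d) := by
      -- A loop splits off for `x` with `!d` and for `y` with `d`, so each side has one factor `1`
      -- and one factor `N`.
      simp only [cutValue, hd, hy', ← e1, ← e2, ← e3]
      cases d <;> simp [add_comm]
    obtain rfl | rfl : c = d ∨ c = !d := by cases c <;> cases d <;> simp
    · exact key
    · simpa using key.symm
  -- The edge `{x, y}` avoids the free leg: the terms at `x` and `y` agree after exchanging the two
  -- free half-edges, and no loop occurs.
  · push Not at hf
    have hxy : y.toFree = freeMate α x.toFree := by
      rw [hy, joinInvolution, if_neg (hf _), if_neg (hf _)]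
    have hy' : freeMate α y.toFree = x.toFree := by rw [hxy, mm]
    have e : ∀ d, cutValue W α x d = cutValue W α y (!d) := fun d => by
      have : cutGraph α x d = cutGraph α y (!d) := cutGraph_eq fun z => by
        have := cutJoin_mate mm mn (p := (none, d)) (q := (none, !d)) (by simp)
          (x.toFree_ne _) (x.toFree_ne _) (hf _) (hf _) (z.toFree_ne _) (z.toFree_ne _)
        simpa [hxy] using this
      simp [cutValue, this, hy', hf, HalfEdge.toFree_ne]
    rw [e c, e (!c), Bool.not_not, add_comm]

/-! ### The terms of the recurrence -/

/-- The position of a half-edge after the free leg has been inserted before the fixed leg `k`. -/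
def insertHalfEdge {n : ℕ} (k : Fin n) : FreeHalfEdge n ≃ HalfEdge (n + 1) :=
  (finSuccEquiv' k.castSucc).symm.prodCongr (Equiv.refl Bool)

theorem ofPerm_insertFreeLeg_mate {n : ℕ} (α : Perm (Option (Fin n))) (k : Fin n)
    (z : FreeHalfEdge n) :
    (ExtGraph.ofPerm (insertFreeLeg α k.castSucc)).mate (insertHalfEdge k z) =
      insertHalfEdge k (freeMate α z) := by
  obtain ⟨v, b⟩ := z
  cases b
  · simp [ExtGraph.ofPerm, insertHalfEdge, freeMate, insertFreeLeg]
  · refine Prod.ext (Perm.inv_eq_iff_eq.2 ?_) rfl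
    simp [insertHalfEdge, freeMate, insertFreeLeg]

theorem insertHalfEdge_none {n : ℕ} (k : Fin n) (c : Bool) :
    insertHalfEdge k (none, c) = (k.castSucc, c) := by
  simp [insertHalfEdge]

theorem insertHalfEdge_toFree {n : ℕ} (k v : Fin n) (c : Bool) :
    insertHalfEdge k (HalfEdge.toFree (v, c)) = (k.castSucc.succAbove v, c) := by
  simp [insertHalfEdge, HalfEdge.toFree]

theorem insertHalfEdge_toFree_self {n : ℕ} (k : Fin n) (c : Bool) :
    insertHalfEdge k (HalfEdge.toFree (k, c)) = (k.succ, c) := by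
  simp [insertHalfEdge_toFree]

theorem joinMate_insertHalfEdge {n : ℕ} (α : Perm (Option (Fin n))) (k : Fin n)
    (p q z : FreeHalfEdge n) :
    ExtGraph.joinMate (m := n + 1) (ExtGraph.ofPerm (insertFreeLeg α k.castSucc))
      (insertHalfEdge k p) (insertHalfEdge k q) (insertHalfEdge k z) =
      insertHalfEdge k (joinInvolution (freeMate α) p q z) := by
  simp only [ExtGraph.joinMate, joinInvolution, ofPerm_insertFreeLeg_mate,
    (insertHalfEdge k).injective.eq_iff]
  split_ifs <;> rfl

/-- Identify the merged vertex with the fixed leg `k`. The surviving free half-edge of kind `!a`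
then replaces the deleted half-edge of kind `b`. The other survivor at `k` had kind `!b` but
receives kind `a`, so head and tail must be exchanged exactly when `a = b`. -/
theorem mergeIncl_eq_insertHalfEdge {n : ℕ} (k : Fin n) (a b : Bool) (h : HalfEdge n) :
    ExtGraph.mergeIncl k a b ((if a = b then swap (k, true) (k, false) else 1 : Perm _) h) =
      insertHalfEdge k (swap (HalfEdge.toFree (k, b)) (none, !a) h.toFree) := by
  obtain ⟨v, c⟩ := h
  by_cases hv : v = k
  · subst hv
    have hs : (v.succ.succAbove v) = v.castSucc := Fin.succAbove_succ_self v
    cases a <;> cases b <;> cases c <;>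
      simp [ExtGraph.mergeIncl, HalfEdge.toFree, swap_apply_def, insertHalfEdge, hs]
  · have h1 : (if a = b then swap (k, true) (k, false) else 1 : Perm _) ((v, c) : HalfEdge n) =
        (v, c) := by
      split_ifs
      · exact swap_apply_of_ne_of_ne (by simp [hv]) (by simp [hv])
      · rfl
    rw [h1, swap_apply_of_ne_of_ne (by simp [HalfEdge.toFree, hv]) (HalfEdge.toFree_ne _ _),
      insertHalfEdge_toFree, ExtGraph.mergeIncl, if_neg (by simp [hv])]
    congr 1
    rcases lt_or_gt_of_ne hv with h | h
    · rw [Fin.succAbove_of_castSucc_lt _ _ (Fin.castSucc_lt_succ_iff.2 h.le),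
        Fin.succAbove_of_castSucc_lt _ _ (Fin.castSucc_lt_castSucc_iff.2 h)]
    · rw [Fin.succAbove_of_le_castSucc _ _ (Fin.succ_le_castSucc_iff.2 h),
        Fin.succAbove_of_le_castSucc _ _ (Fin.castSucc_le_castSucc_iff.2 h.le)]

theorem mergeIncl_merge_mate {m : ℕ} (G : ExtGraph (m + 1)) (k : Fin m) (a b : Bool)
    (h : HalfEdge m) : ExtGraph.mergeIncl k a b ((G.merge k a b).mate h) =
      ExtGraph.joinMate G (k.castSucc, a) (k.succ, b) (ExtGraph.mergeIncl k a b h) := by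
  have s := ExtGraph.joinMate_spec G (by simp [Fin.ext_iff])
    (ExtGraph.mergeIncl_ne_left k a b h) (ExtGraph.mergeIncl_ne_right k a b h)
  exact ExtGraph.mergeIncl_proj k a b _ s.1 s.2.1

theorem joinMate_comm {m : ℕ} (G : ExtGraph m) {p q : HalfEdge m} (hpq : p ≠ q)
    (h : HalfEdge m) : ExtGraph.joinMate G p q h = ExtGraph.joinMate G q p h := by
  unfold ExtGraph.joinMate
  grind

theorem merge_insertFreeLeg_mate {n : ℕ} (α : Perm (Option (Fin n))) (k : Fin n) (a b : Bool)
    (h : HalfEdge n) :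
    ((ExtGraph.ofPerm (insertFreeLeg α k.castSucc)).merge k a b).mate
        ((if a = b then swap (k, true) (k, false) else 1 : Perm _) h) =
      (if a = b then swap (k, true) (k, false) else 1 : Perm _)
        ((cutGraph α (k, b) (!a)).mate h) := by
  -- Compare the two pairings among the half-edges before merging, where both are the same joining
  -- operation.
  apply Function.LeftInverse.injective (ExtGraph.mergeProj_incl k a b)
  rw [mergeIncl_merge_mate, mergeIncl_eq_insertHalfEdge, mergeIncl_eq_insertHalfEdge, cutGraph,
    toFree_restrictFree_mate, cutJoin, swap_apply_swap_apply, ← joinMate_insertHalfEdge,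
    insertHalfEdge_none, insertHalfEdge_toFree_self, Bool.not_not, joinMate_comm]
  simp [Fin.ext_iff]

theorem merge_insertFreeLeg {n : ℕ} (α : Perm (Option (Fin n))) (k : Fin n) (a b : Bool) :
    (ExtGraph.ofPerm (insertFreeLeg α k.castSucc)).merge k a b =
      if a = b then (cutGraph α (k, b) (!a)).flip k else cutGraph α (k, b) (!a) := by
  have key := merge_insertFreeLeg_mate α k a b
  split_ifs at key ⊢ with hab
  · ext1
    funext h
    have := key (swap (k, true) (k, false) h)
    rwa [swap_apply_swap_apply] at this
  · ext1
    funext h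
    exact key h

theorem mergeValue_insertFreeLeg {w : PermFunction} {W : (m : ℕ) → ExtGraph m → SORing}
    (hW : IsSOExtension w W) {n : ℕ} (α : Perm (Option (Fin n))) (k : Fin n) (a b : Bool) :
    mergeValue W (ExtGraph.ofPerm (insertFreeLeg α k.castSucc)) k a b =
      if a = b then -cutValue W α (k, b) (!a) else cutValue W α (k, b) (!a) := by
  have hl : (ExtGraph.ofPerm (insertFreeLeg α k.castSucc)).mergeLoops k a b =
      if freeMate α (HalfEdge.toFree (k, b)) = (none, !(!a)) then 1 else 0 := by
    unfold ExtGraph.mergeLoops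
    refine if_congr ?_ rfl rfl
    rw [← insertHalfEdge_none, ← insertHalfEdge_toFree_self, ofPerm_insertFreeLeg_mate,
      (insertHalfEdge k).injective.eq_iff, Bool.not_not]
    refine ⟨fun e => ?_, fun e => ?_⟩
    · rw [← e, freeMate_freeMate]
    · rw [← e, freeMate_freeMate]
  unfold mergeValue cutValue
  rw [hl, merge_insertFreeLeg]
  split_ifs <;> simp [hW.flip]

theorem swap_mul_insertFreeLeg_mul_swap {n : ℕ} (α : Perm (Option (Fin n))) (k : Fin n) :
    swap k.castSucc k.succ * insertFreeLeg α k.castSucc * swap k.castSucc k.succ =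
      insertFreeLeg α k.succ := by
  have key : ∀ v, swap k.castSucc k.succ ((finSuccEquiv' k.castSucc).symm v) =
      (finSuccEquiv' k.succ).symm v := by
    rintro (_ | v)
    · simp
    · simp only [finSuccEquiv'_symm_some]
      by_cases hv : v = k
      · subst hv
        simp
      · rw [swap_apply_of_ne_of_ne (Fin.succAbove_ne _ _)
          fun e => hv (Fin.succAbove_right_injective
            (e.trans (Fin.succAbove_castSucc_self k).symm))]
        rcases lt_or_gt_of_ne hv with h | h
        · rw [Fin.succAbove_of_castSucc_lt _ _ (Fin.castSucc_lt_succ_iff.2 h.le),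
            Fin.succAbove_of_castSucc_lt _ _ (Fin.castSucc_lt_castSucc_iff.2 h)]
        · rw [Fin.succAbove_of_le_castSucc _ _ (Fin.succ_le_castSucc_iff.2 h),
            Fin.succAbove_of_le_castSucc _ _ (Fin.castSucc_le_castSucc_iff.2 h.le)]
  ext1 u
  obtain ⟨v, rfl⟩ := (finSuccEquiv' k.succ).symm.surjective u
  have : swap k.castSucc k.succ ((finSuccEquiv' k.succ).symm v) =
      (finSuccEquiv' k.castSucc).symm v := by
    rw [← key, swap_apply_swap_apply]
  simp only [Perm.mul_apply, insertFreeLeg, permCongr_apply, symm_symm, this, apply_symm_apply, key]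

/-! ### Summation over a cycle -/

theorem vassilievSum_eq_zero {w : PermFunction} (hw : IsUniversalSOWeightSystem w) {n : ℕ}
    (α : Perm (Option (Fin n))) (x : Option (Fin n)) : vassilievSum w α x = 0 := by
  classical
  obtain ⟨W, hW, hrec⟩ := hw.recurrence
  have hd : ∀ j : Fin n,
      w (n + 1) (insertFreeLeg α j.castSucc) - w (n + 1) (insertFreeLeg α j.succ) =
        ∑ b : Bool, (cutValue W α (j, b) true - cutValue W α (j, b) false) := by
    intro j
    rw [hrec n _ j, swap_mul_insertFreeLeg_mul_swap]
    simp only [mergeValue_insertFreeLeg hW, Fintype.sum_bool]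
    simp only [Bool.not_true, Bool.not_false, if_true, Bool.false_eq_true, if_false,
      Bool.true_eq_false]
    ring
  have hsum : vassilievSum w α x = ∑ h : HalfEdge n with α.SameCycle x (some h.1),
      (cutValue W α h true - cutValue W α h false) := by
    unfold vassilievSum
    rw [Finset.sum_congr rfl fun j _ => hd j, Finset.sum_filter, Finset.sum_filter,
      Fintype.sum_prod_type]
    refine Finset.sum_congr (by rfl) fun j _ => ?_
    split_ifs <;> simp
  rw [hsum]
  -- The involution exchanges the two ends of each edge of the graph without the free leg.
  refine Finset.sum_involution (fun h _ => (forgetFree α).mate h) ?_ ?_ ?_ ?_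
  · intro h _
    have := cutValue_add_cutValue (W := W) α h true
    rw [Bool.not_true] at this
    linear_combination this
  · intro h _ _
    exact (forgetFree α).mate_ne h
  · intro h hh
    simp only [Finset.mem_filter, Finset.mem_univ, true_and] at hh ⊢
    have hm : ((forgetFree α).mate h).toFree =
        joinInvolution (freeMate α) (none, true) (none, false) h.toFree :=
      toFree_restrictFree_mate _ _ _
    change α.SameCycle x ((forgetFree α).mate h).toFree.1
    have h' := (sameCycle_freeMate α x h.toFree).2 hh
    -- If the edge runs into the free leg, it continues from the other free half-edge, still on the
    -- same cycle.
    rw [hm, joinInvolution]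
    split_ifs with h1 h2
    · rw [sameCycle_freeMate]
      rwa [h1] at h'
    · rw [sameCycle_freeMate]
      rwa [h2] at h'
    · exact h'
  · intro h _
    exact (forgetFree α).mate_mate h

theorem mainTheorem2 (w : PermFunction) (hw : IsUniversalSOWeightSystem w) :
    SatisfiesGeneralizedVassilievRelations w :=
  ⟨fun _ α => vassilievSum_eq_zero hw α none, fun _ α i _ => vassilievSum_eq_zero hw α (some i)⟩
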